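/- **Setting.** Let $s\ge 2$ and let $Q^*=(q_{ik})$, $0\le i\le s-1$, $k\ge 1$, be a matrix with $q_{ik}>0$ and $\sum_{i=0}^{s-1}q_{ik}=1$ for every $k$. For digits $\alpha_k\in\{0,\dots,s-1\}$ let $$\Delta_{\alpha_1\alpha_2\ldots}=\sum_{k=1}^{\infty}\Bigl(\sum_{l<\alpha_k}q_{lk}\Bigr)\prod_{j=1}^{k-1}q_{\alpha_j j}\in[0,1],$$ the point with $Q^*$-expansion $(\alpha_k)$. Let $\xi_1,\xi_2,\dots$ be independent random variables with values in $\{0,\dots,s-1\}$, $P(\xi_k=i)=p_{ik}$, let $\xi=\Delta_{\xi_1\xi_2\ldots}$, and let $\nu$ be the distribution of $\xi$. The Hausdorff dimension of $\nu$ is $$\dim_H\nu=\inf\{\dim_H E:\ E\text{ Borel},\ \nu(E)=1\}.$$ Put $q_k=\max_i q_{ik}$, $S(m,\delta)=\sum_{k=1}^\infty\bigl(\prod_{i=m+1}^{m+k}q_i\bigr)^{\delta}$, $S(\delta)=\sup_{m\ge 0} S(m,\delta)$ and, with $0\ln 0=0$, $$h_j=-\sum_i p_{ij}\ln p_{ij},\quad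 H_n=\sum_{j=1}^n h_j,\quad b_j=-\sum_i p_{ij}\ln q_{ij},\quad B_n=\sum_{j=1}^n b_j,\quad d_j=-b_j^2+\sum_i p_{ij}\ln^2 q_{ij}.$$ **Theorem.** Assume that $$S(\delta)<+\infty\ \text{ for all }\delta>0,\qquad \sum_{j=1}^\infty\frac{d_j}{j^2}<+\infty,\qquad \liminf_{n\to\infty}\frac{B_n}{n}>0$$ (the last lower limit may be $+\infty$). Then $$\dim_H\nu=\liminf_{n\to\infty}\frac{H_n}{B_n}.$$ Moreover, the infimum defining $\dim_H\nu$ is attained by the set $A$ of all points $x=\Delta_{\alpha_1\alpha_2\ldots}$ having an expansion with $p_{\alpha_j j}>0$ for all $j$ and $$\lim_{n\to\infty}\left(\frac{\sum_{j=1}^n\ln p_{\alpha_j j}}{\sum_{j=1}^n\ln q_{\alpha_j j}}-\frac{H_n}{B_n}\right)=0;$$ that is, $A$ is a Borel set, $\nu(A)=1$ and $\dim_H A=\dim_H\nu$. -/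

import Mathlib

open MeasureTheory ProbabilityTheory Filter Topology
open scoped ENNReal

noncomputable section

namespace QStar

/-! Columns are numbered from `0`: column `k` here is the column usually numbered `k + 1`.
A matrix is a function `q : Fin s → ℕ → ℝ`, with `q i k` the entry for digit `i` in column `k`. -/

/-- `Δ_{α₁α₂…} = β_{α₁,1} + ∑_{k ≥ 2} β_{α_k,k} ∏_{j < k} q_{α_j,j}`, `β_{i,k} = ∑_{l < i} q_{l,k}`:
the point of `[0,1]` with `Q*`-expansion `α`. -/
def point {s : ℕ} (q : Fin s → ℕ → ℝ) (α : ℕ → Fin s) : ℝ :=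
  ∑' k : ℕ, (∑ l ∈ Finset.Iio (α k), q l k) * ∏ j ∈ Finset.range k, q (α j) j

/-- `q_k = max_i q_{ik}`. -/
def colMax {s : ℕ} (q : Fin s → ℕ → ℝ) (k : ℕ) : ℝ := ⨆ i : Fin s, q i k

/-- `S(m, δ) = ∑_{k ≥ 1} (∏_{i=m+1}^{m+k} q_i)^δ`, with values in `[0, ∞]`. -/
def tailSum {s : ℕ} (q : Fin s → ℕ → ℝ) (m : ℕ) (δ : ℝ) : ℝ≥0∞ :=
  ∑' k : ℕ, ENNReal.ofReal ((∏ i ∈ Finset.range (k + 1), colMax q (m + i)) ^ δ)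

/-- `S(δ) = sup_m S(m, δ)`. -/
def supTailSum {s : ℕ} (q : Fin s → ℕ → ℝ) (δ : ℝ) : ℝ≥0∞ := ⨆ m : ℕ, tailSum q m δ

/-- `h_j = -∑_i p_{ij} ln p_{ij}`, with `0 ln 0 = 0`. -/
def entropy {s : ℕ} (p : Fin s → ℕ → ℝ) (j : ℕ) : ℝ := -∑ i : Fin s, p i j * Real.log (p i j)

/-- `H_n`, the sum of the first `n` digit entropies. -/
def cumEntropy {s : ℕ} (p : Fin s → ℕ → ℝ) (n : ℕ) : ℝ := ∑ j ∈ Finset.range n, entropy p j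

/-- `b_j = -∑_i p_{ij} ln q_{ij}`. -/
def crossEntropy {s : ℕ} (p q : Fin s → ℕ → ℝ) (j : ℕ) : ℝ :=
  -∑ i : Fin s, p i j * Real.log (q i j)

/-- `B_n`, the sum of the first `n` of the `b_j`. -/
def cumCrossEntropy {s : ℕ} (p q : Fin s → ℕ → ℝ) (n : ℕ) : ℝ :=
  ∑ j ∈ Finset.range n, crossEntropy p q j

/-- `d_j = -b_j² + ∑_i p_{ij} ln² q_{ij}`. -/
def digitVariance {s : ℕ} (p q : Fin s → ℕ → ℝ) (j : ℕ) : ℝ :=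
  -(crossEntropy p q j) ^ 2 + ∑ i : Fin s, p i j * (Real.log (q i j)) ^ 2

/-- The Hausdorff dimension of a distribution: the infimum of the Hausdorff dimensions of its
(not necessarily closed) Borel supports. -/
def dimDistribution (ν : Measure ℝ) : ℝ≥0∞ :=
  ⨅ (E : Set ℝ) (_ : MeasurableSet E ∧ ν E = 1), dimH E

/-- The set of points `x` having an expansion `α` with
`(∑_{j ≤ n} ln p_{α_j,j}) / (∑_{j ≤ n} ln q_{α_j,j}) - H_n / B_n → 0`. An expansion using a digit of
probability zero is excluded: there `ln p = -∞`, so that the limit relation fails. -/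
def minimalSupport {s : ℕ} (p q : Fin s → ℕ → ℝ) : Set ℝ :=
  {x | ∃ α : ℕ → Fin s, point q α = x ∧ (∀ j, 0 < p (α j) j) ∧
    Tendsto (fun n : ℕ =>
      (∑ j ∈ Finset.range n, Real.log (p (α j) j)) / (∑ j ∈ Finset.range n, Real.log (q (α j) j))
        - cumEntropy p n / cumCrossEntropy p q n) atTop (𝓝 0)}

end QStar

end

/-! Along a digit sequence, the product of the p's is the probability of following its first n
digits and the product of the q's is the length of the corresponding cylinder, so the quotient of
logarithms is a local dimension along cylinders. Kolmogorov's strong law, applied to ln q (variances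
d_j) and to ln p (variances at most 4s), shows that almost surely the two sums of logarithms are
-B_n + o(n) and -H_n + o(n). Since H_n ≤ s n and B_n > c n eventually, the quotient differs from
H_n/B_n by o(1), so ν is carried by A (`ae_mem_minimalDigits`).

Upper bound (`dimH_image_point_le`): if liminf H_n/B_n < a < t, every point of A lies in infinitely
many cylinders with length^a ≤ mass. Then length^t ≤ mass · (maximal length)^(t-a). Masses of one
rank add up to 1, and the powers of the maximal lengths are summable over ranks, so the Hausdorff
sums of these covers tend to 0.

Lower bound (`le_dimH_of_massBounded`): if t < u < liminf H_n/B_n, almost every sequence satisfies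
mass ≤ K · length^u with some K. A set of diameter at most r is covered by cylinders stopped when
their length first drops to r or below. At most 2s of them are needed for each stopping rank, and
part of the exponent, δ = u - t, is spent on summing over ranks. This replaces a lower bound on the
q's and yields the mass distribution principle with exponent t. -/

open scoped NNReal

/-! ### Strong law of large numbers -/

/-- Kronecker's lemma for the weights `1 / (j + 1)`. -/
theorem tendsto_inv_mul_sum_of_tendsto_sum_div {x : ℕ → ℝ} {c : ℝ}
    (h : Tendsto (fun n => ∑ j ∈ Finset.range n, x j / ((j : ℝ) + 1)) atTop (𝓝 c)) :
    Tendsto (fun n : ℕ => (n : ℝ)⁻¹ * ∑ j ∈ Finset.range n, x j) atTop (𝓝 0) := by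
  set S : ℕ → ℝ := fun n => ∑ j ∈ Finset.range n, x j / ((j : ℝ) + 1) with hS
  -- Summation by parts. After division by n the right side is S n minus a Cesàro mean of S, and
  -- both tend to c.
  have key : ∀ n : ℕ, ∑ j ∈ Finset.range n, x j = n * S n - ∑ j ∈ Finset.range n, S j := by
    intro n
    induction n with
    | zero => simp
    | succ n ih =>
      have h1 : S (n + 1) = S n + x n / ((n : ℝ) + 1) := Finset.sum_range_succ _ _
      have hn : ((n : ℝ) + 1) ≠ 0 := by positivity
      rw [Finset.sum_range_succ, Finset.sum_range_succ, ih, h1]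
      push_cast
      field_simp
      ring
  have h2 := h.sub h.cesaro
  rw [sub_self] at h2
  refine h2.congr' ?_
  filter_upwards [eventually_gt_atTop 0] with n hn
  have hn' : (n : ℝ) ≠ 0 := by positivity
  rw [key n]
  field_simp

section

variable {Ω : Type*} [MeasurableSpace Ω] {P : Measure Ω} [IsProbabilityMeasure P]

/-- A series of independent centred random variables with summable variances converges almost
surely. -/
theorem ProbabilityTheory.iIndepFun.ae_exists_tendsto_sum {Y : ℕ → Ω → ℝ}
    (hm : ∀ j, Measurable (Y j)) (hL : ∀ j, MemLp (Y j) 2 P) (hi : iIndepFun Y P)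
    (h0 : ∀ j, ∫ ω, Y j ω ∂P = 0) (hs : Summable fun j => variance (Y j) P) :
    ∀ᵐ ω ∂P, ∃ c, Tendsto (fun n => ∑ j ∈ Finset.range n, Y j ω) atTop (𝓝 c) := by
  have hsm : ∀ j, StronglyMeasurable (Y j) := fun j => (hm j).stronglyMeasurable
  set ℱ := Filtration.natural Y hsm with hℱ
  -- The sum runs up to and including n because the natural filtration at time n already contains `Y
  -- n`.
  set M : ℕ → Ω → ℝ := fun n ω => ∑ j ∈ Finset.range (n + 1), Y j ω with hM
  have hint : ∀ j, Integrable (Y j) P := fun j => (hL j).integrable one_le_two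
  have hMint : ∀ n, Integrable (M n) P := fun n => integrable_finsetSum _ fun j _ => hint j
  have hML : ∀ n, MemLp (M n) 2 P := fun n => memLp_finsetSum _ fun j _ => hL j
  have hM0 : ∀ n, ∫ ω, M n ω ∂P = 0 := fun n => by
    simp only [hM]
    rw [integral_finsetSum _ fun j _ => hint j]
    simp [h0]
  have hadp : StronglyAdapted ℱ M := by
    intro n
    refine Finset.stronglyMeasurable_fun_sum _ fun j hj => ?_
    exact ((Filtration.stronglyAdapted_natural hsm) j).mono
      (ℱ.mono (Nat.lt_succ_iff.1 (Finset.mem_range.1 hj)))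
  have hmart : Martingale M ℱ P := by
    refine martingale_of_condExp_sub_eq_zero_nat hadp hMint fun n => ?_
    have h1 : M (n + 1) - M n = Y (n + 1) := by
      ext ω
      simp [hM, Finset.sum_range_succ _ (n + 1)]
    rw [h1]
    refine (iIndepFun.condExp_natural_ae_eq_of_lt hsm hi (Nat.lt_succ_self n)).trans ?_
    simp [h0]; rfl
  have hvar : ∀ n, variance (M n) P ≤ ∑' j, variance (Y j) P := by
    intro n
    have h1 : M n = ∑ j ∈ Finset.range (n + 1), Y j := by ext ω; simp [hM]
    rw [h1, IndepFun.variance_sum (fun j _ => hL j) (fun i _ j _ hij => hi.indepFun hij)]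
    exact hs.sum_le_tsum _ fun j _ => variance_nonneg _ _
  have hbdd : ∀ n, eLpNorm (M n) 1 P ≤ ((1 + Real.toNNReal (∑' j, variance (Y j) P) : NNReal) : ℝ≥0∞) := by
    intro n
    rw [eLpNorm_one_eq_lintegral_enorm]
    -- The inequality |x| ≤ 1 + x² turns the uniform variance bound into the L¹ bound required for
    -- martingale convergence.
    calc ∫⁻ ω, ‖M n ω‖ₑ ∂P ≤ ∫⁻ ω, (1 + ‖M n ω - ∫ x, M n x ∂P‖ₑ ^ 2) ∂P := by
          refine lintegral_mono fun ω => ?_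
          rw [hM0, sub_zero]
          rcases le_total ‖M n ω‖ₑ 1 with h | h
          · exact h.trans le_self_add
          · refine le_trans ?_ le_add_self
            rw [pow_two]
            exact le_mul_of_one_le_left' h
      _ = 1 + evariance (M n) P := by
          rw [lintegral_add_left measurable_const]
          simp [evariance]
      _ ≤ _ := by
          rw [← (hML n).ofReal_variance_eq, ENNReal.coe_add]
          gcongr
          · simp
          · exact ENNReal.ofReal_le_ofReal (hvar n)
  filter_upwards [hmart.submartingale.exists_ae_tendsto_of_bdd hbdd] with ω ⟨c, hc⟩
  exact ⟨c, (tendsto_add_atTop_iff_nat 1).1 hc⟩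

/-- Kolmogorov's strong law of large numbers. -/
theorem ProbabilityTheory.iIndepFun.ae_tendsto_inv_mul_sum_sub {X : ℕ → Ω → ℝ}
    (hm : ∀ j, Measurable (X j)) (hL : ∀ j, MemLp (X j) 2 P) (hi : iIndepFun X P)
    (hs : Summable fun j : ℕ => variance (X j) P / ((j : ℝ) + 1) ^ 2) :
    ∀ᵐ ω ∂P, Tendsto (fun n : ℕ => (n : ℝ)⁻¹ *
      ∑ j ∈ Finset.range n, (X j ω - ∫ x, X j x ∂P)) atTop (𝓝 0) := by
  have hint : ∀ j, Integrable (X j) P := fun j => (hL j).integrable one_le_two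
  let g : ℕ → ℝ → ℝ := fun j x => (x - ∫ x, X j x ∂P) / ((j : ℝ) + 1)
  have hg : ∀ j, Measurable (g j) := fun j => by fun_prop
  have hY := iIndepFun.ae_exists_tendsto_sum (P := P) (Y := fun j => g j ∘ X j)
    (fun j => (hg j).comp (hm j))
    (fun j => by
      have := ((hL j).sub (memLp_const (∫ x, X j x ∂P))).const_mul ((j : ℝ) + 1)⁻¹
      refine this.ae_eq (ae_of_all _ fun ω => ?_)
      simp [g, div_eq_inv_mul])
    (hi.comp g hg)
    (fun j => by
      simp only [g, Function.comp]
      rw [integral_div, integral_sub (hint j) (integrable_const _)]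
      simp)
    (by
      refine hs.congr fun j => ?_
      have h1 : g j ∘ X j = fun ω => ((j : ℝ) + 1)⁻¹ * (X j ω - ∫ x, X j x ∂P) := by
        ext ω; simp [g, div_eq_inv_mul]
      rw [h1, variance_const_mul, variance_sub_const (hm j).aestronglyMeasurable]
      field_simp)
  filter_upwards [hY] with ω ⟨c, hc⟩
  exact tendsto_inv_mul_sum_of_tendsto_sum_div hc

end

/-! ### Cylinders and the coding map -/

namespace QStar

section Geometry

variable {s : ℕ}

/-- The product of the entries of `q` along the first `n` digits of `α`; for the matrix `q` itself,
the length of the cylinder of rank `n` containing `α`. -/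
noncomputable def cylProd (q : Fin s → ℕ → ℝ) (α : ℕ → Fin s) (n : ℕ) : ℝ :=
  ∏ j ∈ Finset.range n, q (α j) j

/-- The left endpoint of the cylinder of rank `n` containing `α`. -/
noncomputable def leftEnd (q : Fin s → ℕ → ℝ) (α : ℕ → Fin s) (n : ℕ) : ℝ :=
  ∑ k ∈ Finset.range n, (∑ l ∈ Finset.Iio (α k), q l k) * cylProd q α k

theorem cylProd_zero (q : Fin s → ℕ → ℝ) (α : ℕ → Fin s) : cylProd q α 0 = 1 := by simp [cylProd]

theorem cylProd_succ (q : Fin s → ℕ → ℝ) (α : ℕ → Fin s) (n : ℕ) :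
    cylProd q α (n + 1) = cylProd q α n * q (α n) n := Finset.prod_range_succ _ _

theorem leftEnd_succ (q : Fin s → ℕ → ℝ) (α : ℕ → Fin s) (n : ℕ) :
    leftEnd q α (n + 1) = leftEnd q α n + (∑ l ∈ Finset.Iio (α n), q l n) * cylProd q α n :=
  Finset.sum_range_succ _ _

theorem cylProd_congr (q : Fin s → ℕ → ℝ) {α β : ℕ → Fin s} {n : ℕ} (h : ∀ j < n, α j = β j) :
    cylProd q α n = cylProd q β n :=
  Finset.prod_congr rfl fun j hj => by rw [h j (Finset.mem_range.1 hj)]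

theorem leftEnd_congr (q : Fin s → ℕ → ℝ) {α β : ℕ → Fin s} {n : ℕ} (h : ∀ j < n, α j = β j) :
    leftEnd q α n = leftEnd q β n :=
  Finset.sum_congr rfl fun j hj => by
    have hj := Finset.mem_range.1 hj
    rw [h j hj, cylProd_congr q fun i hi => h i (hi.trans hj)]

variable {q : Fin s → ℕ → ℝ}

theorem cylProd_pos (hq : ∀ i k, 0 < q i k) (α : ℕ → Fin s) (n : ℕ) : 0 < cylProd q α n :=
  Finset.prod_pos fun _ _ => hq _ _

theorem sum_Iio_add_le {k : ℕ} (hq : ∀ i k, 0 < q i k) {i j : Fin s} (hij : i < j) :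
    ∑ l ∈ Finset.Iio i, q l k + q i k ≤ ∑ l ∈ Finset.Iio j, q l k := by
  have h : ∑ l ∈ insert i (Finset.Iio i), q l k = ∑ l ∈ Finset.Iio i, q l k + q i k := by
    rw [Finset.sum_insert (by simp), add_comm]
  rw [← h]
  refine Finset.sum_le_sum_of_subset_of_nonneg (fun l hl => ?_) fun l _ _ => (hq l k).le
  rcases Finset.mem_insert.1 hl with rfl | hl
  · simpa using hij
  · simpa using (Finset.mem_Iio.1 hl).trans hij

theorem sum_Iio_add_le_one {k : ℕ} (hq : ∀ i k, 0 < q i k) (hsum : ∀ k, ∑ i, q i k = 1)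
    (i : Fin s) : ∑ l ∈ Finset.Iio i, q l k + q i k ≤ 1 := by
  have h : ∑ l ∈ insert i (Finset.Iio i), q l k = ∑ l ∈ Finset.Iio i, q l k + q i k := by
    rw [Finset.sum_insert (by simp), add_comm]
  rw [← h, ← hsum k]
  exact Finset.sum_le_sum_of_subset_of_nonneg (Finset.subset_univ _) fun l _ _ => (hq l k).le

theorem leftEnd_mono (hq : ∀ i k, 0 < q i k) (α : ℕ → Fin s) : Monotone (leftEnd q α) :=
  monotone_nat_of_le_succ fun n => by
    rw [leftEnd_succ]
    exact le_add_of_nonneg_right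
      (mul_nonneg (Finset.sum_nonneg fun l _ => (hq l n).le) (cylProd_pos hq α n).le)

/-- The sum is the right endpoint of the cylinder, and each child interval lies inside its parent.
-/
theorem leftEnd_add_cylProd_antitone (hq : ∀ i k, 0 < q i k) (hsum : ∀ k, ∑ i, q i k = 1)
    (α : ℕ → Fin s) : Antitone fun n => leftEnd q α n + cylProd q α n :=
  antitone_nat_of_succ_le fun n => by
    rw [leftEnd_succ, cylProd_succ]
    nlinarith [sum_Iio_add_le_one (k := n) hq hsum (α n), cylProd_pos hq α n]

theorem tendsto_leftEnd (hq : ∀ i k, 0 < q i k) (hsum : ∀ k, ∑ i, q i k = 1) (α : ℕ → Fin s) :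
    Tendsto (leftEnd q α) atTop (𝓝 (point q α)) := by
  refine Summable.tendsto_sum_tsum_nat (f := fun k => (∑ l ∈ Finset.Iio (α k), q l k) *
    ∏ j ∈ Finset.range k, q (α j) j) (summable_of_sum_range_le (c := 1) (fun n => ?_) fun n => ?_)
  · exact mul_nonneg (Finset.sum_nonneg fun l _ => (hq l n).le) (cylProd_pos hq α n).le
  · have h := leftEnd_add_cylProd_antitone hq hsum α (Nat.zero_le n)
    simp only [cylProd_zero] at h
    have h0 : leftEnd q α 0 = 0 := by simp [leftEnd]
    have := cylProd_pos hq α n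
    change leftEnd q α n ≤ 1
    linarith

theorem leftEnd_le_point (hq : ∀ i k, 0 < q i k) (hsum : ∀ k, ∑ i, q i k = 1) (α : ℕ → Fin s)
    (n : ℕ) : leftEnd q α n ≤ point q α :=
  (leftEnd_mono hq α).ge_of_tendsto (tendsto_leftEnd hq hsum α) n

theorem point_le_leftEnd_add (hq : ∀ i k, 0 < q i k) (hsum : ∀ k, ∑ i, q i k = 1) (α : ℕ → Fin s)
    (n : ℕ) : point q α ≤ leftEnd q α n + cylProd q α n := by
  refine le_of_tendsto (tendsto_leftEnd hq hsum α) ?_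
  filter_upwards [eventually_ge_atTop n] with m hm
  have := leftEnd_add_cylProd_antitone hq hsum α hm
  have := cylProd_pos hq α m
  simp only at *
  linarith

theorem abs_point_sub_point_le (hq : ∀ i k, 0 < q i k) (hsum : ∀ k, ∑ i, q i k = 1)
    {α β : ℕ → Fin s} {n : ℕ} (h : ∀ j < n, α j = β j) :
    |point q α - point q β| ≤ cylProd q α n := by
  have h1 := leftEnd_le_point hq hsum α n
  have h2 := point_le_leftEnd_add hq hsum α n
  have h3 := leftEnd_le_point hq hsum β n
  have h4 := point_le_leftEnd_add hq hsum β n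
  rw [← leftEnd_congr q h] at h3 h4
  rw [← cylProd_congr q h] at h4
  rw [abs_le]
  constructor <;> linarith

/-- If `α` precedes `β` lexicographically, with first difference at `k`, every cylinder of rank
above `k` containing `α` lies to the left of every such cylinder containing `β`. -/
theorem leftEnd_add_cylProd_le (hq : ∀ i k, 0 < q i k) (hsum : ∀ k, ∑ i, q i k = 1)
    {α β : ℕ → Fin s} {k m n : ℕ} (h : ∀ j < k, α j = β j) (hlt : α k < β k) (hm : k < m)
    (hn : k < n) : leftEnd q α m + cylProd q α m ≤ leftEnd q β n := by
  refine (leftEnd_add_cylProd_antitone hq hsum α hm).trans (le_trans ?_ (leftEnd_mono hq β hn))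
  simp only [Nat.succ_eq_add_one]
  rw [leftEnd_succ, leftEnd_succ, cylProd_succ, leftEnd_congr q h, cylProd_congr q h]
  nlinarith [sum_Iio_add_le (k := k) hq hlt, cylProd_pos hq β k]

theorem exists_first_ne {n : ℕ} {α β : ℕ → Fin s} (h : ¬ ∀ j < n, α j = β j) :
    ∃ k < n, (∀ j < k, α j = β j) ∧ α k ≠ β k := by
  classical
  push Not at h
  refine ⟨Nat.find h, (Nat.find_spec h).1, fun j hj => ?_, (Nat.find_spec h).2⟩
  by_contra hne
  exact Nat.find_min h hj ⟨hj.trans (Nat.find_spec h).1, hne⟩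

/-- Distinct cylinders of the same rank do not overlap. -/
theorem leftEnd_add_cylProd_le_or (hq : ∀ i k, 0 < q i k) (hsum : ∀ k, ∑ i, q i k = 1)
    {α β : ℕ → Fin s} {n : ℕ} (h : ¬ ∀ j < n, α j = β j) :
    leftEnd q α n + cylProd q α n ≤ leftEnd q β n ∨
      leftEnd q β n + cylProd q β n ≤ leftEnd q α n := by
  obtain ⟨k, hk, heq, hne⟩ := exists_first_ne h
  rcases lt_or_gt_of_ne hne with hlt | hlt
  · exact Or.inl (leftEnd_add_cylProd_le hq hsum heq hlt hk hk)
  · exact Or.inr (leftEnd_add_cylProd_le hq hsum (fun j hj => (heq j hj).symm) hlt hk hk)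

theorem measurable_leftEnd (n : ℕ) : Measurable fun α : ℕ → Fin s => leftEnd q α n := by
  refine Finset.measurable_sum _ fun k _ => Measurable.mul ?_ ?_
  · exact (Measurable.of_discrete (f := fun i : Fin s => ∑ l ∈ Finset.Iio i, q l k)).comp
      (measurable_pi_apply k)
  · exact Finset.measurable_prod _ fun j _ =>
      (Measurable.of_discrete (f := fun i : Fin s => q i j)).comp (measurable_pi_apply j)

theorem measurable_point (hq : ∀ i k, 0 < q i k) (hsum : ∀ k, ∑ i, q i k = 1) :
    Measurable (point q) :=
  measurable_of_tendsto_metrizable measurable_leftEnd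
    (tendsto_pi_nhds.2 fun α => tendsto_leftEnd hq hsum α)

/-- The digit sequences that are eventually minimal. -/
def eventuallyMin (s : ℕ) : Set (ℕ → Fin s) := {α | ∃ n, ∀ j ≥ n, IsMin (α j)}

theorem countable_eventuallyMin (s : ℕ) : (eventuallyMin s).Countable := by
  have h : eventuallyMin s = ⋃ n, {α | ∀ j ≥ n, IsMin (α j)} := by
    ext; simp [eventuallyMin]
  rw [h]
  refine Set.countable_iUnion fun n => Set.MapsTo.countable_of_injOn
    (f := fun α (i : Fin n) => α i) (Set.mapsTo_univ _ _) ?_ (Set.to_countable _)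
  intro α hα β hβ hab
  funext j
  rcases lt_or_ge j n with hj | hj
  · exact congr_fun hab ⟨j, hj⟩
  · rcases le_total (α j) (β j) with h | h
    · exact h.antisymm (hβ j hj h)
    · exact (hα j hj h).antisymm h

/-- The cylinder of `α` lies to the left of that of `β`, so equal points force the left endpoints
for `β` to be constant beyond rank k. As all entries of `q` are positive, no later digit of `β` can
have a smaller digit below it. -/
theorem mem_eventuallyMin_of_point_eq (hq : ∀ i k, 0 < q i k) (hsum : ∀ k, ∑ i, q i k = 1)
    {α β : ℕ → Fin s} {k : ℕ} (h : ∀ j < k, α j = β j) (hlt : α k < β k)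
    (hp : point q α = point q β) : β ∈ eventuallyMin s := by
  refine ⟨k + 1, fun j hj => ?_⟩
  have h1 := leftEnd_add_cylProd_le hq hsum h hlt (Nat.lt_succ_self k) (Nat.lt_succ_self k)
  have h2 := point_le_leftEnd_add hq hsum α (k + 1)
  have h3 := leftEnd_le_point hq hsum β (j + 1)
  have h4 := leftEnd_mono hq β hj
  rw [leftEnd_succ] at h3
  have h5 : ∑ l ∈ Finset.Iio (β j), q l j ≤ 0 := by
    by_contra hpos
    have := mul_pos (not_le.1 hpos) (cylProd_pos hq β j)
    simp only [Nat.succ_eq_add_one] at *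
    linarith
  intro l hl
  by_contra hlt'
  have : q l j ≤ ∑ l ∈ Finset.Iio (β j), q l j :=
    Finset.single_le_sum (f := fun l => q l j) (fun i _ => (hq i j).le)
      (Finset.mem_Iio.2 (not_le.1 hlt'))
  exact absurd (hq l j) (by linarith)

theorem injOn_point (hq : ∀ i k, 0 < q i k) (hsum : ∀ k, ∑ i, q i k = 1) :
    Set.InjOn (point q) (eventuallyMin s)ᶜ := by
  intro α hα β hβ hp
  by_contra hne
  obtain ⟨n, hn⟩ := Function.ne_iff.1 hne
  obtain ⟨k, -, heq, hk⟩ := exists_first_ne (n := n + 1) (α := α) (β := β)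
    fun h => hn (h n (Nat.lt_succ_self n))
  rcases lt_or_gt_of_ne hk with hlt | hlt
  · exact hβ (mem_eventuallyMin_of_point_eq hq hsum heq hlt hp)
  · exact hα (mem_eventuallyMin_of_point_eq hq hsum (fun j hj => (heq j hj).symm) hlt hp.symm)

/-- Off a countable set of sequences the coding map is injective, where Lusin–Souslin applies; the
remaining image is countable. -/
theorem measurableSet_image_point (hq : ∀ i k, 0 < q i k) (hsum : ∀ k, ∑ i, q i k = 1)
    {D : Set (ℕ → Fin s)} (hD : MeasurableSet D) : MeasurableSet (point q '' D) := by
  rw [← Set.sdiff_union_inter D (eventuallyMin s), Set.image_union]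
  refine MeasurableSet.union ?_ ?_
  · exact (hD.diff (countable_eventuallyMin s).measurableSet).image_of_measurable_injOn
      (measurable_point hq hsum) ((injOn_point hq hsum).mono fun α h => h.2)
  · exact (((countable_eventuallyMin s).mono Set.inter_subset_right).image _).measurableSet

end Geometry

/-! ### Measurability of the minimal support -/

/-- The digit sequences defining `minimalSupport`. -/
def minimalDigits {s : ℕ} (p q : Fin s → ℕ → ℝ) : Set (ℕ → Fin s) :=
  {α | (∀ j, 0 < p (α j) j) ∧
    Tendsto (fun n : ℕ =>
      (∑ j ∈ Finset.range n, Real.log (p (α j) j)) / (∑ j ∈ Finset.range n, Real.log (q (α j) j))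
        - cumEntropy p n / cumCrossEntropy p q n) atTop (𝓝 0)}

theorem minimalSupport_eq_image {s : ℕ} (p q : Fin s → ℕ → ℝ) :
    minimalSupport p q = point q '' minimalDigits p q := by
  ext x
  constructor
  · rintro ⟨α, h1, h2⟩
    exact ⟨α, h2, h1⟩
  · rintro ⟨α, h2, h1⟩
    exact ⟨α, h1, h2⟩

theorem measurableSet_minimalDigits {s : ℕ} (p q : Fin s → ℕ → ℝ) :
    MeasurableSet (minimalDigits p q) := by
  have hlog : ∀ (r : Fin s → ℕ → ℝ) (n : ℕ), Measurable fun α : ℕ → Fin s =>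
      ∑ j ∈ Finset.range n, Real.log (r (α j) j) := fun r n =>
    Finset.measurable_sum _ fun j _ =>
      (Measurable.of_discrete (f := fun i : Fin s => Real.log (r i j))).comp (measurable_pi_apply j)
  have hset : minimalDigits p q = (⋂ j, {α | 0 < p (α j) j}) ∩ {α | Tendsto (fun n : ℕ =>
      (∑ j ∈ Finset.range n, Real.log (p (α j) j)) / (∑ j ∈ Finset.range n, Real.log (q (α j) j))
        - cumEntropy p n / cumCrossEntropy p q n) atTop (𝓝 0)} := by
    ext; simp [minimalDigits]
  rw [hset]
  refine MeasurableSet.inter ?_ ?_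
  · exact MeasurableSet.iInter fun j =>
      (MeasurableSet.of_discrete (s := {i : Fin s | 0 < p i j})).preimage
        (measurable_pi_apply (X := fun _ : ℕ => Fin s) j)
  · exact measurableSet_tendsto (f := fun (n : ℕ) (α : ℕ → Fin s) =>
      (∑ j ∈ Finset.range n, Real.log (p (α j) j)) / (∑ j ∈ Finset.range n, Real.log (q (α j) j))
        - cumEntropy p n / cumCrossEntropy p q n) (𝓝 0)
      fun n => ((hlog p n).div (hlog q n)).sub measurable_const

end QStar

/-! ### Almost sure behaviour of the digits -/

namespace QStar

/-- For sums of logarithms `a` and `b`, the expected values are -H and -B, hence the plus signs.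
Errors of order o(n) do not affect the quotient because H is O(n) and B grows at least linearly. -/
theorem tendsto_div_sub_div_of_tendsto {a b H B : ℕ → ℝ} {c C : ℝ} (hc : 0 < c)
    (ha : Tendsto (fun n : ℕ => (n : ℝ)⁻¹ * (a n + H n)) atTop (𝓝 0))
    (hb : Tendsto (fun n : ℕ => (n : ℝ)⁻¹ * (b n + B n)) atTop (𝓝 0))
    (hH : ∀ n : ℕ, |H n| ≤ C * n) (hB : ∀ᶠ n : ℕ in atTop, c * n < B n) :
    Tendsto (fun n => a n / b n - H n / B n) atTop (𝓝 0) := by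
  -- The coefficients come from the eventual bounds |n / b n| ≤ 2/c and |H n / B n| ≤ C/c.
  have hlim : Tendsto (fun n : ℕ => 2 / c * |(n : ℝ)⁻¹ * (a n + H n)| +
      C / c * (2 / c) * |(n : ℝ)⁻¹ * (b n + B n)|) atTop (𝓝 0) := by
    have := (ha.abs.const_mul (2 / c)).add (hb.abs.const_mul (C / c * (2 / c)))
    simpa using this
  refine squeeze_zero_norm' ?_ hlim
  filter_upwards [hB, eventually_gt_atTop 0, hb.abs.eventually_lt_const
    (show |(0 : ℝ)| < c / 2 by rw [abs_zero]; positivity)] with n hBn hn hbn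
  have hn' : (0 : ℝ) < n := by exact_mod_cast hn
  set u := (n : ℝ)⁻¹ * (a n + H n) with hu
  set v := (n : ℝ)⁻¹ * (b n + B n) with hv
  have ha' : a n + H n = n * u := by rw [hu]; field_simp
  have hb' : b n + B n = n * v := by rw [hv]; field_simp
  have hBpos : 0 < B n := lt_trans (by positivity) hBn
  have hbneg : c / 2 * n ≤ -b n := by
    have : -b n = B n - n * v := by linarith
    have hv2 := (abs_lt.1 hbn).2
    nlinarith
  have hbneg' : b n < 0 := by nlinarith
  have hnb : |n / b n| ≤ 2 / c := by
    rw [abs_div, abs_of_pos hn', abs_of_neg hbneg', div_le_div_iff₀ (by linarith) hc]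
    linarith
  have hHB : |H n / B n| ≤ C / c := by
    rw [abs_div, abs_of_pos hBpos, div_le_div_iff₀ hBpos hc]
    have hC : 0 ≤ C := by
      by_contra h
      have := (abs_nonneg _).trans (hH n)
      nlinarith
    nlinarith [hH n]
  have heq : a n / b n - H n / B n = n / b n * u - H n / B n * (n / b n) * v := by
    have h1 : a n = n * u - H n := by linarith
    have hbne := hbneg'.ne
    have hBne := hBpos.ne'
    rw [h1]
    clear_value u v
    field_simp
    linear_combination (-H n) * hb'
  rw [heq, Real.norm_eq_abs]
  refine (abs_sub _ _).trans ?_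
  rw [abs_mul, abs_mul (_ * _) v, abs_mul (H n / B n)]
  gcongr
  exact (abs_nonneg _).trans hHB

/-- Apply |y ln y| < 1 to y = √x and square. This bounds the variances of ln p by 4s, however small
the probabilities are. -/
theorem mul_log_sq_le {x : ℝ} (h0 : 0 ≤ x) (h1 : x ≤ 1) : x * Real.log x ^ 2 ≤ 4 := by
  rcases h0.eq_or_lt with rfl | h0
  · simp
  have hs : 0 < √x := Real.sqrt_pos.2 h0
  have h := Real.abs_log_mul_self_lt (√x) hs (Real.sqrt_le_one.2 h1)
  rw [Real.log_sqrt h0.le] at h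
  have h2 : (Real.log x / 2 * √x) ^ 2 ≤ 1 := (sq_le_one_iff_abs_le_one _).2 h.le
  rw [mul_pow, Real.sq_sqrt h0.le] at h2
  linarith

theorem prob_nonneg {Ω : Type*} [MeasurableSpace Ω] {P : Measure Ω} {s : ℕ} {p : Fin s → ℕ → ℝ}
    {ξ : ℕ → Ω → Fin s} (hlaw : ∀ i k, P.real {ω | ξ k ω = i} = p i k) (i : Fin s) (k : ℕ) :
    0 ≤ p i k := by
  rw [← hlaw]; exact measureReal_nonneg

section

variable {Ω : Type*} [MeasurableSpace Ω] {P : Measure Ω} [IsProbabilityMeasure P] {s : ℕ}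
  {p q : Fin s → ℕ → ℝ} {ξ : ℕ → Ω → Fin s}

theorem integral_digit (hm : ∀ k, Measurable (ξ k)) (hlaw : ∀ i k, P.real {ω | ξ k ω = i} = p i k)
    (f : Fin s → ℝ) (k : ℕ) : ∫ ω, f (ξ k ω) ∂P = ∑ i, p i k * f i := by
  have := Measure.isProbabilityMeasure_map (μ := P) (hm k).aemeasurable
  rw [← integral_map (hm k).aemeasurable (f := f) (Measurable.of_discrete).aestronglyMeasurable,
    integral_fintype (Integrable.of_finite)]
  refine Finset.sum_congr rfl fun i _ => ?_
  rw [map_measureReal_apply (hm k) (MeasurableSet.singleton i), ← hlaw i k, smul_eq_mul]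
  rfl

theorem memLp_digit (hm : ∀ k, Measurable (ξ k)) (f : Fin s → ℝ) (k : ℕ) :
    MemLp (fun ω => f (ξ k ω)) 2 P :=
  MemLp.of_bound ((Measurable.of_discrete (f := f)).comp (hm k)).aestronglyMeasurable
    (∑ i, |f i|) (ae_of_all _ fun _ =>
      Finset.single_le_sum (f := fun i => |f i|) (fun _ _ => abs_nonneg _) (Finset.mem_univ _))

theorem variance_digit (hm : ∀ k, Measurable (ξ k)) (hlaw : ∀ i k, P.real {ω | ξ k ω = i} = p i k)
    (f : Fin s → ℝ) (k : ℕ) :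
    variance (fun ω => f (ξ k ω)) P = ∑ i, p i k * f i ^ 2 - (∑ i, p i k * f i) ^ 2 := by
  rw [variance_eq_sub (memLp_digit hm f k), ← integral_digit hm hlaw f,
    ← integral_digit (P := P) hm hlaw (fun i => f i ^ 2)]
  rfl

theorem prob_le_one (hlaw : ∀ i k, P.real {ω | ξ k ω = i} = p i k) (i : Fin s) (k : ℕ) :
    p i k ≤ 1 := by
  rw [← hlaw]; exact measureReal_le_one

theorem sum_prob (hm : ∀ k, Measurable (ξ k)) (hlaw : ∀ i k, P.real {ω | ξ k ω = i} = p i k)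
    (k : ℕ) : ∑ i, p i k = 1 := by
  have := integral_digit (P := P) hm hlaw (fun _ => 1) k
  simpa using this.symm

theorem ae_tendsto_sum_digit (hm : ∀ k, Measurable (ξ k)) (hi : iIndepFun ξ P)
    (hlaw : ∀ i k, P.real {ω | ξ k ω = i} = p i k) (f : Fin s → ℕ → ℝ)
    (hs : Summable fun j : ℕ =>
      (∑ i, p i j * f i j ^ 2 - (∑ i, p i j * f i j) ^ 2) / ((j : ℝ) + 1) ^ 2) :
    ∀ᵐ ω ∂P, Tendsto (fun n : ℕ => (n : ℝ)⁻¹ * (∑ j ∈ Finset.range n, f (ξ j ω) j +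
      ∑ j ∈ Finset.range n, -∑ i, p i j * f i j)) atTop (𝓝 0) := by
  have h := iIndepFun.ae_tendsto_inv_mul_sum_sub (P := P) (X := fun j ω => f (ξ j ω) j)
    (fun j => (Measurable.of_discrete (f := fun i => f i j)).comp (hm j))
    (fun j => memLp_digit hm (fun i => f i j) j)
    (hi.comp (fun j i => f i j) fun j => Measurable.of_discrete)
    (hs.congr fun j => by rw [variance_digit hm hlaw (fun i => f i j) j])
  filter_upwards [h] with ω hω
  refine hω.congr fun n => ?_
  rw [← Finset.sum_add_distrib]
  congr 1
  refine Finset.sum_congr rfl fun j _ => ?_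
  rw [integral_digit hm hlaw (fun i => f i j) j, sub_eq_add_neg]

theorem entropy_nonneg (hlaw : ∀ i k, P.real {ω | ξ k ω = i} = p i k) (j : ℕ) :
    0 ≤ entropy p j := by
  rw [entropy, neg_nonneg]
  exact Finset.sum_nonpos fun i _ => mul_nonpos_of_nonneg_of_nonpos (prob_nonneg hlaw i j)
    (Real.log_nonpos (prob_nonneg hlaw i j) (prob_le_one hlaw i j))

theorem cumEntropy_nonneg (hlaw : ∀ i k, P.real {ω | ξ k ω = i} = p i k) (n : ℕ) :
    0 ≤ cumEntropy p n := Finset.sum_nonneg fun j _ => entropy_nonneg hlaw j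

theorem cumEntropy_le (hlaw : ∀ i k, P.real {ω | ξ k ω = i} = p i k) (n : ℕ) :
    cumEntropy p n ≤ s * n := by
  have h : ∀ j, entropy p j ≤ s := fun j => by
    rw [entropy, ← Finset.sum_neg_distrib]
    calc ∑ i, -(p i j * Real.log (p i j)) ≤ ∑ _i : Fin s, (1 : ℝ) := by
          refine Finset.sum_le_sum fun i _ => ?_
          rcases (prob_nonneg hlaw i j).eq_or_lt with h0 | h0
          · simp [← h0]
          · have := Real.abs_log_mul_self_lt _ h0 (prob_le_one hlaw i j)
            rw [mul_comm]
            linarith [(abs_lt.1 this).1]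
      _ = s := by simp
  calc cumEntropy p n ≤ ∑ _j ∈ Finset.range n, (s : ℝ) := Finset.sum_le_sum fun j _ => h j
    _ = s * n := by simp [mul_comm]

theorem exists_cumCrossEntropy_gt
    (hB : 0 < liminf (fun n : ℕ => ((cumCrossEntropy p q n / (n : ℝ) : ℝ) : EReal)) atTop) :
    ∃ c : ℝ, 0 < c ∧ ∀ᶠ n : ℕ in atTop, c * n < cumCrossEntropy p q n := by
  obtain ⟨c, hc0, hc⟩ := EReal.lt_iff_exists_real_btwn.1 hB
  refine ⟨c, by exact_mod_cast hc0, ?_⟩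
  filter_upwards [eventually_lt_of_lt_liminf hc, eventually_gt_atTop 0] with n hn hn0
  have hn0' : (0 : ℝ) < n := by exact_mod_cast hn0
  exact (lt_div_iff₀ hn0').1 (by exact_mod_cast hn)

theorem ae_prob_pos (hlaw : ∀ i k, P.real {ω | ξ k ω = i} = p i k) :
    ∀ᵐ ω ∂P, ∀ j, 0 < p (ξ j ω) j := by
  rw [ae_all_iff]
  intro j
  have h : ∀ i : Fin s, ∀ᵐ ω ∂P, ξ j ω = i → 0 < p i j := by
    intro i
    rcases (prob_nonneg hlaw i j).eq_or_lt with h0 | h0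
    · have h1 : P {ω | ξ j ω = i} = 0 := by
        rw [← measureReal_eq_zero_iff, hlaw, h0]
      filter_upwards [measure_eq_zero_iff_ae_notMem.1 h1] with ω hω h2
      exact absurd h2 hω
    · exact ae_of_all _ fun _ _ => h0
  filter_upwards [ae_all_iff.2 h] with ω hω
  exact hω _ rfl

theorem ae_mem_minimalDigits (hm : ∀ k, Measurable (ξ k)) (hi : iIndepFun ξ P)
    (hlaw : ∀ i k, P.real {ω | ξ k ω = i} = p i k)
    (hd : Summable fun j : ℕ => digitVariance p q j / ((j : ℝ) + 1) ^ 2)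
    (hB : 0 < liminf (fun n : ℕ => ((cumCrossEntropy p q n / (n : ℝ) : ℝ) : EReal)) atTop) :
    ∀ᵐ ω ∂P, (fun k => ξ k ω) ∈ minimalDigits p q := by
  obtain ⟨c, hc, hcB⟩ := exists_cumCrossEntropy_gt hB
  have h1 := ae_tendsto_sum_digit hm hi hlaw (fun i j => Real.log (q i j)) (hd.congr fun j => by
    rw [digitVariance, crossEntropy, neg_sq]; ring)
  have h2 := ae_tendsto_sum_digit hm hi hlaw (fun i j => Real.log (p i j)) (by
    have hsq : Summable fun j : ℕ => (s * 4 : ℝ) * (1 / ((j : ℝ) + 1) ^ 2) := by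
      refine Summable.mul_left _ ?_
      have := (summable_nat_add_iff 1).2 (Real.summable_one_div_nat_pow.2 one_lt_two)
      simpa using this
    refine Summable.of_nonneg_of_le (fun j => ?_) (fun j => ?_) hsq
    · rw [← variance_digit hm hlaw (fun i => Real.log (p i j)) j]
      exact div_nonneg (variance_nonneg _ _) (by positivity)
    · rw [← div_eq_mul_one_div]
      gcongr
      have : ∑ i, p i j * Real.log (p i j) ^ 2 ≤ ∑ _i : Fin s, (4 : ℝ) :=
        Finset.sum_le_sum fun i _ => mul_log_sq_le (prob_nonneg hlaw i j) (prob_le_one hlaw i j)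
      simp only [Finset.sum_const, Finset.card_univ, Fintype.card_fin, nsmul_eq_mul] at this
      nlinarith [sq_nonneg (∑ i, p i j * Real.log (p i j))])
  filter_upwards [h1, h2, ae_prob_pos hlaw] with ω hω1 hω2 hω3
  exact ⟨hω3, tendsto_div_sub_div_of_tendsto hc hω2 hω1
    (fun n => by
      rw [abs_of_nonneg (cumEntropy_nonneg hlaw n)]; exact cumEntropy_le hlaw n) hcB⟩

end

end QStar

/-! ### Upper bound by covering with cylinders -/

namespace QStar

section Covering

variable {s : ℕ} {p q : Fin s → ℕ → ℝ}

/-- The largest length of a cylinder of rank `n`. -/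
noncomputable def maxProd (q : Fin s → ℕ → ℝ) (n : ℕ) : ℝ := ∏ i ∈ Finset.range n, colMax q i

theorem le_colMax (q : Fin s → ℕ → ℝ) (i : Fin s) (k : ℕ) : q i k ≤ colMax q k :=
  le_ciSup (f := fun i => q i k) (Set.finite_range _).bddAbove i

theorem neZero_of_sum_eq_one (hsum : ∀ k, ∑ i, q i k = 1) : NeZero s :=
  ⟨by rintro rfl; simpa using hsum 0⟩

theorem colMax_le_one (hq : ∀ i k, 0 < q i k) (hsum : ∀ k, ∑ i, q i k = 1) (k : ℕ) :
    colMax q k ≤ 1 := by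
  have := neZero_of_sum_eq_one hsum
  refine ciSup_le fun i => ?_
  rw [← hsum k]
  exact Finset.single_le_sum (f := fun i => q i k) (fun i _ => (hq i k).le) (Finset.mem_univ i)

theorem colMax_pos (hq : ∀ i k, 0 < q i k) (hsum : ∀ k, ∑ i, q i k = 1) (k : ℕ) :
    0 < colMax q k := by
  have := neZero_of_sum_eq_one hsum
  exact (hq 0 k).trans_le (le_colMax q 0 k)

theorem maxProd_pos (hq : ∀ i k, 0 < q i k) (hsum : ∀ k, ∑ i, q i k = 1) (n : ℕ) :
    0 < maxProd q n := Finset.prod_pos fun _ _ => colMax_pos hq hsum _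

theorem maxProd_antitone (hq : ∀ i k, 0 < q i k) (hsum : ∀ k, ∑ i, q i k = 1) :
    Antitone (maxProd q) :=
  antitone_nat_of_succ_le fun n => by
    rw [maxProd, Finset.prod_range_succ]
    exact mul_le_of_le_one_right (maxProd_pos hq hsum n).le (colMax_le_one hq hsum n)

theorem cylProd_le_maxProd (hq : ∀ i k, 0 < q i k) (α : ℕ → Fin s) (n : ℕ) :
    cylProd q α n ≤ maxProd q n :=
  Finset.prod_le_prod (fun _ _ => (hq _ _).le) fun j _ => le_colMax q (α j) j

theorem tsum_maxProd_rpow_ne_top {δ : ℝ} (h : supTailSum q δ < ∞) :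
    ∑' k, ENNReal.ofReal (maxProd q (k + 1) ^ δ) ≠ ∞ := by
  have h0 := ((le_iSup (tailSum q · δ) 0).trans_lt h).ne
  simpa only [tailSum, maxProd, zero_add] using h0

theorem tendsto_maxProd (hq : ∀ i k, 0 < q i k) (hsum : ∀ k, ∑ i, q i k = 1)
    (hS : ∀ δ : ℝ, 0 < δ → supTailSum q δ < ∞) : Tendsto (maxProd q) atTop (𝓝 0) := by
  have h := ENNReal.tendsto_atTop_zero_of_tsum_ne_top (tsum_maxProd_rpow_ne_top (hS 1 one_pos))
  simp only [Real.rpow_one] at h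
  have h2 := (ENNReal.tendsto_toReal ENNReal.zero_ne_top).comp h
  refine (tendsto_add_atTop_iff_nat 1).1 (h2.congr fun k => ?_)
  simp [ENNReal.toReal_ofReal (maxProd_pos hq hsum (k + 1)).le]

theorem log_cylProd {α : ℕ → Fin s} (h : ∀ j, 0 < q (α j) j) (n : ℕ) :
    Real.log (cylProd q α n) = ∑ j ∈ Finset.range n, Real.log (q (α j) j) :=
  Real.log_prod fun j _ => (h j).ne'

theorem eventually_sum_log_neg (hq : ∀ i k, 0 < q i k) (hsum : ∀ k, ∑ i, q i k = 1)
    (hS : ∀ δ : ℝ, 0 < δ → supTailSum q δ < ∞) (α : ℕ → Fin s) :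
    ∀ᶠ n in atTop, ∑ j ∈ Finset.range n, Real.log (q (α j) j) < 0 := by
  filter_upwards [(tendsto_maxProd hq hsum hS).eventually_lt_const one_pos] with n hn
  rw [← log_cylProd fun j => hq _ _]
  exact Real.log_neg (cylProd_pos hq α n) ((cylProd_le_maxProd hq α n).trans_lt hn)

theorem sum_prod_word_eq_one (hp : ∀ k, ∑ i, p i k = 1) (n : ℕ) :
    ∑ w : Fin n → Fin s, ∏ i : Fin n, p (w i) i = 1 := by
  rw [← Fintype.piFinset_univ,
    ← Finset.prod_univ_sum (t := fun _ => Finset.univ) (f := fun (i : Fin n) j => p j i)]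
  simp [hp]

theorem cylProd_eq_prod_word {n : ℕ} {w : Fin n → Fin s} {α : ℕ → Fin s} (h : ∀ i : Fin n, α i = w i) :
    cylProd q α n = ∏ i : Fin n, q (w i) i := by
  rw [cylProd, Finset.prod_range]
  exact Finset.prod_congr rfl fun i _ => by rw [h]

theorem ediam_image_cylinder_le (hq : ∀ i k, 0 < q i k) (hsum : ∀ k, ∑ i, q i k = 1) {n : ℕ}
    {w : Fin n → Fin s} {A : Set (ℕ → Fin s)} (hA : ∀ α ∈ A, ∀ i : Fin n, α i = w i) :
    Metric.ediam (point q '' A) ≤ ENNReal.ofReal (∏ i : Fin n, q (w i) i) := by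
  refine Metric.ediam_le ?_
  rintro _ ⟨α, hα, rfl⟩ _ ⟨β, hβ, rfl⟩
  rw [edist_dist, Real.dist_eq, ← cylProd_eq_prod_word (hA α hα)]
  refine ENNReal.ofReal_le_ofReal (abs_point_sub_point_le hq hsum fun j hj => ?_)
  rw [hA α hα ⟨j, hj⟩, hA β hβ ⟨j, hj⟩]

/-- If every sequence of `D` has infinitely many cylinders whose mass exceeds a power `a < t` of
the length, then the points of `D` form a set of dimension at most `t`. -/
theorem dimH_image_point_le (hq : ∀ i k, 0 < q i k) (hsum : ∀ k, ∑ i, q i k = 1)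
    (hp0 : ∀ i k, 0 ≤ p i k) (hp : ∀ k, ∑ i, p i k = 1)
    (hS : ∀ δ : ℝ, 0 < δ → supTailSum q δ < ∞) {a : ℝ} {t : ℝ≥0} (ht : 0 < t) (hat : a < t)
    {D : Set (ℕ → Fin s)}
    (hD : ∀ α ∈ D, ∃ᶠ n in atTop, cylProd q α n ^ a ≤ cylProd p α n) :
    dimH (point q '' D) ≤ t := by
  set ε : ℝ := t - a with hε
  have hε0 : 0 < ε := sub_pos.2 hat
  let f : ℕ → ℝ≥0∞ := fun k => ENNReal.ofReal (maxProd q (k + 1) ^ ε)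
  -- The N-th cover uses only ranks n + N + 1, so its mesh tends to 0 as N grows; cylinders without
  -- a sequence of large mass contribute empty sets.
  let cyl : ∀ N : ℕ, (Σ n : ℕ, (Fin (n + N + 1) → Fin s)) → Set (ℕ → Fin s) := fun N x =>
    {α | (∀ i : Fin (x.1 + N + 1), α i = x.2 i) ∧
      cylProd q α (x.1 + N + 1) ^ a ≤ cylProd p α (x.1 + N + 1)}
  have hpow : ∀ N x, Metric.ediam (point q '' cyl N x) ^ (t : ℝ) ≤
      ENNReal.ofReal (∏ i, p (x.2 i) i) * f (x.1 + N) := by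
    intro N x
    rcases (cyl N x).eq_empty_or_nonempty with h | ⟨α, hα⟩
    · have ht' : (0 : ℝ) < t := by exact_mod_cast ht
      rw [h, Set.image_empty, Metric.ediam_empty, ENNReal.zero_rpow_of_pos ht']
      exact zero_le
    · have h1 := ediam_image_cylinder_le hq hsum (w := x.2) (A := cyl N x) fun α hα => hα.1
      have hpos := cylProd_pos hq α (x.1 + N + 1)
      refine (ENNReal.rpow_le_rpow h1 t.coe_nonneg).trans ?_
      rw [← cylProd_eq_prod_word hα.1, ← cylProd_eq_prod_word hα.1,
        ENNReal.ofReal_rpow_of_nonneg hpos.le t.coe_nonneg,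
        ← ENNReal.ofReal_mul (show 0 ≤ cylProd p α _ from Finset.prod_nonneg fun j _ => hp0 _ _)]
      refine ENNReal.ofReal_le_ofReal ?_
      -- Of the exponent t = a + ε, the part a is absorbed by the mass and ε by the maximal length.
      rw [show ((t : ℝ≥0) : ℝ) = a + ε by rw [hε]; ring, Real.rpow_add hpos]
      exact mul_le_mul hα.2 (Real.rpow_le_rpow hpos.le (cylProd_le_maxProd hq _ _) hε0.le)
        (Real.rpow_nonneg hpos.le _) (Finset.prod_nonneg fun j _ => hp0 _ _)
  have hsumN : ∀ N, ∑' x, Metric.ediam (point q '' cyl N x) ^ (t : ℝ) ≤ ∑' n, f (n + N) := by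
    intro N
    refine (ENNReal.tsum_le_tsum (hpow N)).trans ?_
    rw [ENNReal.tsum_sigma']
    refine ENNReal.tsum_le_tsum fun n => ?_
    dsimp only
    rw [ENNReal.tsum_mul_right, tsum_fintype, ← ENNReal.ofReal_sum_of_nonneg
      fun w _ => Finset.prod_nonneg fun i _ => hp0 _ _, sum_prod_word_eq_one hp]
    simp
  have hlim : Tendsto (fun N => ∑' n, f (n + N)) atTop (𝓝 0) :=
    ENNReal.tendsto_sum_nat_add f (tsum_maxProd_rpow_ne_top (hS ε hε0))
  refine dimH_le_of_hausdorffMeasure_ne_top (ne_top_of_le_ne_top ENNReal.zero_ne_top ?_)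
  refine (Measure.hausdorffMeasure_le_liminf_tsum (t : ℝ) (point q '' D)
    (fun N => ENNReal.ofReal (maxProd q (N + 1))) (l := atTop) ?_
    (fun N x => point q '' cyl N x) ?_ ?_).trans ?_
  · have := ENNReal.tendsto_ofReal ((tendsto_add_atTop_iff_nat 1).2 (tendsto_maxProd hq hsum hS))
    simpa using this
  · refine Eventually.of_forall fun N x => ?_
    rcases (cyl N x).eq_empty_or_nonempty with h | ⟨α, hα⟩
    · rw [h, Set.image_empty, Metric.ediam_empty]
      exact zero_le
    · refine (ediam_image_cylinder_le hq hsum (w := x.2) (A := cyl N x) fun α hα => hα.1).trans ?_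
      rw [← cylProd_eq_prod_word hα.1]
      exact ENNReal.ofReal_le_ofReal ((cylProd_le_maxProd hq _ _).trans
        (maxProd_antitone hq hsum (by omega)))
  · refine Eventually.of_forall fun N => ?_
    rintro _ ⟨α, hα, rfl⟩
    obtain ⟨m, hm, hm'⟩ := (frequently_atTop.1 (hD α hα)) (N + 1)
    obtain ⟨n, rfl⟩ := Nat.exists_eq_add_of_le' hm
    exact Set.mem_iUnion.2 ⟨⟨n, fun i => α i⟩, α, ⟨fun _ => rfl, hm'⟩, rfl⟩
  · refine (liminf_le_liminf (Eventually.of_forall hsumN)).trans ?_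
    rw [hlim.liminf_eq]

/-- For liminf < c < a < t, the ratio H_n/B_n is below c infinitely often and the quotient of
logarithms is then below a from some rank on. Multiplying by the negative denominator reverses the
inequality and gives length^a ≤ mass. -/
theorem dimH_minimalSupport_le (hq : ∀ i k, 0 < q i k) (hsum : ∀ k, ∑ i, q i k = 1)
    (hp0 : ∀ i k, 0 ≤ p i k) (hp : ∀ k, ∑ i, p i k = 1)
    (hS : ∀ δ : ℝ, 0 < δ → supTailSum q δ < ∞) {t : ℝ≥0} (ht : 0 < t)
    (hlt : liminf (fun n : ℕ => ((cumEntropy p n / cumCrossEntropy p q n : ℝ) : EReal)) atTop <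
      ((t : ℝ) : EReal)) :
    dimH (minimalSupport p q) ≤ t := by
  obtain ⟨c, hc1, hc2⟩ := EReal.lt_iff_exists_real_btwn.1 hlt
  obtain ⟨a, hca, hat⟩ := exists_between (EReal.coe_lt_coe_iff.1 hc2)
  rw [minimalSupport_eq_image]
  refine dimH_image_point_le hq hsum hp0 hp hS ht hat fun α hα => ?_
  have h1 := frequently_lt_of_liminf_lt (by isBoundedDefault) hc1
  refine (h1.and_eventually ((hα.2.eventually_lt_const (sub_pos.2 hca)).and
    (eventually_sum_log_neg hq hsum hS α))).mono ?_
  rintro n ⟨hn1, hn2, hn3⟩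
  have hn1 : cumEntropy p n / cumCrossEntropy p q n < c := by exact_mod_cast hn1
  have hr : (∑ j ∈ Finset.range n, Real.log (p (α j) j)) /
      (∑ j ∈ Finset.range n, Real.log (q (α j) j)) < a := by linarith
  rw [div_lt_iff_of_neg hn3, ← log_cylProd hα.1, ← log_cylProd fun j => hq _ _] at hr
  have hpos : 0 < cylProd p α n := Finset.prod_pos fun j _ => hα.1 j
  rw [Real.rpow_def_of_pos (cylProd_pos hq α n), ← Real.le_log_iff_exp_le hpos]
  linarith

end Covering

end QStar

/-! ### Lower bound by mass distribution -/

namespace QStar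

section MassDistribution

variable {s : ℕ} {p q : Fin s → ℕ → ℝ}

theorem finite_image_leftEnd (hsum : ∀ k, ∑ i, q i k = 1) (A : Set (ℕ → Fin s)) (k : ℕ) :
    ((fun α => leftEnd q α k) '' A).Finite := by
  have := neZero_of_sum_eq_one hsum
  refine (Set.finite_range fun w : Fin k → Fin s =>
    leftEnd q (fun j => if h : j < k then w ⟨j, h⟩ else 0) k).subset ?_
  rintro _ ⟨α, -, rfl⟩
  exact ⟨fun i => α i, leftEnd_congr q fun j hj => by simp [hj]⟩

/-- A set of diameter at most `r` meets at most two cylinders of a given rank that are longer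
than `r`. -/
theorem exists_two_cylinders (hq : ∀ i k, 0 < q i k) (hsum : ∀ k, ∑ i, q i k = 1)
    {A : Set (ℕ → Fin s)} (hA : A.Nonempty) {r : ℝ} {k : ℕ} (hlen : ∀ α ∈ A, r < cylProd q α k)
    (hdiam : ∀ α ∈ A, ∀ β ∈ A, |point q α - point q β| ≤ r) :
    ∃ γ : Fin 2 → ℕ → Fin s, ∀ α ∈ A, ∃ c, ∀ j < k, α j = γ c j := by
  have hfin := finite_image_leftEnd (q := q) hsum A k
  have hne := hA.image fun α => leftEnd q α k
  -- The leftmost and rightmost cylinders are the two sought: a third one would lie between them and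
  -- force a distance exceeding r.
  obtain ⟨_, ⟨α₀, hα₀, rfl⟩, h₀⟩ := Set.exists_min_image _ id hfin hne
  obtain ⟨_, ⟨α₁, hα₁, rfl⟩, h₁⟩ := Set.exists_max_image _ id hfin hne
  refine ⟨![α₀, α₁], fun α hα => ?_⟩
  by_contra! hcon
  have hm₀ : leftEnd q α₀ k ≤ leftEnd q α k := h₀ _ ⟨α, hα, rfl⟩
  have hm₁ : leftEnd q α k ≤ leftEnd q α₁ k := h₁ _ ⟨α, hα, rfl⟩
  have hpos := cylProd_pos hq α k
  have hpos₁ := cylProd_pos hq α₁ k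
  have hn₀ : ¬ ∀ j < k, α j = α₀ j := by
    obtain ⟨j, hj, hj'⟩ := hcon 0
    exact fun h => hj' (h j hj)
  have hn₁ : ¬ ∀ j < k, α j = α₁ j := by
    obtain ⟨j, hj, hj'⟩ := hcon 1
    exact fun h => hj' (h j hj)
  have e₀ : leftEnd q α₀ k + cylProd q α₀ k ≤ leftEnd q α k :=
    (leftEnd_add_cylProd_le_or hq hsum hn₀).resolve_left (by linarith)
  have e₁ : leftEnd q α k + cylProd q α k ≤ leftEnd q α₁ k :=
    (leftEnd_add_cylProd_le_or hq hsum hn₁).resolve_right (by linarith)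
  have := point_le_leftEnd_add hq hsum α₀ k
  have := leftEnd_le_point hq hsum α₁ k
  have := (abs_le.1 (hdiam α₁ hα₁ α₀ hα₀)).2
  have := hlen α hα
  linarith

/-- The sequences all of whose cylinders have mass at most `K` times the power `u` of the length. -/
def massBounded (p q : Fin s → ℕ → ℝ) (u K : ℝ) : Set (ℕ → Fin s) :=
  {α | ∀ n, cylProd p α n ≤ K * cylProd q α n ^ u}

variable {Ω : Type*} [MeasurableSpace Ω] {P : Measure Ω} [IsProbabilityMeasure P]
  {ξ : ℕ → Ω → Fin s}

theorem measure_cylinder (hi : iIndepFun ξ P) (hlaw : ∀ i k, P.real {ω | ξ k ω = i} = p i k)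
    (α : ℕ → Fin s) (n : ℕ) :
    P {ω | ∀ j < n, ξ j ω = α j} = ENNReal.ofReal (cylProd p α n) := by
  have h : {ω | ∀ j < n, ξ j ω = α j} = ⋂ j ∈ Finset.range n, ξ j ⁻¹' {α j} := by
    ext; simp
  rw [h, hi.measure_inter_preimage_eq_mul _ fun _ _ => MeasurableSet.singleton _, cylProd,
    ENNReal.ofReal_prod_of_nonneg fun j _ => prob_nonneg hlaw _ _]
  refine Finset.prod_congr rfl fun j _ => ?_
  rw [← hlaw, ofReal_measureReal]
  rfl

/-- At most two cylinders of rank k are involved, each with s children of rank k + 1. A child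
containing a sequence of `A` has length at most r, hence mass at most K r^u. -/
theorem measure_stopped_le (hi : iIndepFun ξ P)
    (hlaw : ∀ i k, P.real {ω | ξ k ω = i} = p i k) (hq : ∀ i k, 0 < q i k)
    (hsum : ∀ k, ∑ i, q i k = 1) {u K r : ℝ} (hu : 0 ≤ u) (hK : 0 ≤ K)
    {T : Set ℝ} (hT : ∀ x ∈ T, ∀ y ∈ T, |x - y| ≤ r) {A : Set (ℕ → Fin s)}
    (hA : A ⊆ massBounded p q u K) (hAT : ∀ α ∈ A, point q α ∈ T) {k : ℕ}
    (hlen : ∀ α ∈ A, r < cylProd q α k) (hlen' : ∀ α ∈ A, cylProd q α (k + 1) ≤ r) :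
    P {ω | (fun j => ξ j ω) ∈ A} ≤ (2 * s : ℕ) * ENNReal.ofReal (K * r ^ u) := by
  rcases A.eq_empty_or_nonempty with rfl | hne
  · simp
  obtain ⟨γ, hγ⟩ := exists_two_cylinders hq hsum hne hlen
    fun α hα β hβ => hT _ (hAT α hα) _ (hAT β hβ)
  let C : Fin 2 × Fin s → Set Ω := fun x =>
    {ω | (fun j => ξ j ω) ∈ A ∧ (∀ j < k, ξ j ω = γ x.1 j) ∧ ξ k ω = x.2}
  have hsub : {ω | (fun j => ξ j ω) ∈ A} ⊆ ⋃ x, C x := fun ω hω => by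
    obtain ⟨c, hc⟩ := hγ _ hω
    exact Set.mem_iUnion.2 ⟨(c, ξ k ω), hω, hc, rfl⟩
  have hC : ∀ x, P (C x) ≤ ENNReal.ofReal (K * r ^ u) := by
    intro x
    rcases (C x).eq_empty_or_nonempty with h | ⟨ω₀, hω₀, h1, h2⟩
    · simp [h]
    · calc P (C x) ≤ P {ω | ∀ j < k + 1, ξ j ω = ξ j ω₀} := by
            refine measure_mono ?_
            rintro ω ⟨-, h3, h4⟩ j hj
            rcases (Nat.lt_succ_iff_lt_or_eq.1 hj) with hj | rfl
            · rw [h3 j hj, h1 j hj]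
            · rw [h4, h2]
        _ = ENNReal.ofReal (cylProd p (fun j => ξ j ω₀) (k + 1)) :=
            measure_cylinder hi hlaw (fun j => ξ j ω₀) (k + 1)
        _ ≤ _ := by
            refine ENNReal.ofReal_le_ofReal ((hA hω₀ (k + 1)).trans ?_)
            have := (cylProd_pos hq (fun j => ξ j ω₀) (k + 1)).le
            gcongr
            exact hlen' _ hω₀
  calc P {ω | (fun j => ξ j ω) ∈ A} ≤ ∑ x, P (C x) :=
        (measure_mono hsub).trans (measure_iUnion_fintype_le _ _)
    _ ≤ ∑ _x : Fin 2 × Fin s, ENNReal.ofReal (K * r ^ u) := Finset.sum_le_sum fun x _ => hC x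
    _ = _ := by simp

/-- Split by the rank k + 1 at which the length first becomes at most r. The length at rank k still
exceeds r, so r^δ is at most the δ-th power of the maximal length, which is summable over k. -/
theorem measure_massBounded_inter_le (hi : iIndepFun ξ P)
    (hlaw : ∀ i k, P.real {ω | ξ k ω = i} = p i k) (hq : ∀ i k, 0 < q i k)
    (hsum : ∀ k, ∑ i, q i k = 1) (hS : ∀ δ : ℝ, 0 < δ → supTailSum q δ < ∞)
    {t δ K r : ℝ} (ht : 0 ≤ t) (hδ : 0 < δ) (hK : 0 ≤ K) (hr : 0 < r) (hr1 : r < 1)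
    {T : Set ℝ} (hT : ∀ x ∈ T, ∀ y ∈ T, |x - y| ≤ r) :
    P {ω | (fun j => ξ j ω) ∈ massBounded p q (t + δ) K ∩ point q ⁻¹' T} ≤
      ((2 * s : ℕ) * ENNReal.ofReal K * ∑' k, ENNReal.ofReal (maxProd q k ^ δ)) *
        ENNReal.ofReal r ^ t := by
  let A : ℕ → Set (ℕ → Fin s) := fun k => {α | α ∈ massBounded p q (t + δ) K ∩ point q ⁻¹' T ∧
    r < cylProd q α k ∧ cylProd q α (k + 1) ≤ r}
  have hsub : {ω | (fun j => ξ j ω) ∈ massBounded p q (t + δ) K ∩ point q ⁻¹' T} ⊆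
      ⋃ k, {ω | (fun j => ξ j ω) ∈ A k} := by
    intro ω hω
    have hex : ∃ n, cylProd q (fun j => ξ j ω) n ≤ r := by
      obtain ⟨n, hn⟩ := ((tendsto_maxProd hq hsum hS).eventually_lt_const hr).exists
      exact ⟨n, (cylProd_le_maxProd hq _ n).trans hn.le⟩
    classical
    have hmin := fun m => Nat.find_min hex (m := m)
    have hspec := Nat.find_spec hex
    rcases hfind : Nat.find hex with _ | k
    -- The stopping rank is not 0, since the cylinder of rank 0 has length 1 > r.
    · rw [hfind, cylProd_zero] at hspec
      linarith
    · rw [hfind] at hspec hmin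
      exact Set.mem_iUnion.2 ⟨k, hω, not_le.1 (hmin k (Nat.lt_succ_self k)), hspec⟩
  have hA : ∀ k, P {ω | (fun j => ξ j ω) ∈ A k} ≤
      (2 * s : ℕ) * ENNReal.ofReal (K * r ^ t) * ENNReal.ofReal (maxProd q k ^ δ) := by
    intro k
    rcases (A k).eq_empty_or_nonempty with h | ⟨α, hα⟩
    · simp [h]
    · refine (measure_stopped_le hi hlaw hq hsum (add_nonneg ht hδ.le) hK hT (A := A k)
        (fun α hα => hα.1.1) (fun α hα => hα.1.2) (fun α hα => hα.2.1)
        fun α hα => hα.2.2).trans ?_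
      rw [mul_assoc, ← ENNReal.ofReal_mul (by positivity), Real.rpow_add hr, ← mul_assoc K]
      gcongr
      exact hα.2.1.le.trans (cylProd_le_maxProd hq α k)
  calc _ ≤ ∑' k, P {ω | (fun j => ξ j ω) ∈ A k} :=
        (measure_mono hsub).trans (measure_iUnion_le _)
    _ ≤ ∑' k, (2 * s : ℕ) * ENNReal.ofReal (K * r ^ t) * ENNReal.ofReal (maxProd q k ^ δ) :=
        ENNReal.tsum_le_tsum hA
    _ = _ := by
        rw [ENNReal.tsum_mul_left, ENNReal.ofReal_mul hK, ENNReal.ofReal_rpow_of_nonneg hr.le ht]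
        ring

theorem le_dimH_of_massBounded (hm : ∀ k, Measurable (ξ k)) (hi : iIndepFun ξ P)
    (hlaw : ∀ i k, P.real {ω | ξ k ω = i} = p i k) (hq : ∀ i k, 0 < q i k)
    (hsum : ∀ k, ∑ i, q i k = 1) (hS : ∀ δ : ℝ, 0 < δ → supTailSum q δ < ∞)
    {t : ℝ≥0} {u K : ℝ} (htu : t < u) (hK : 0 ≤ K) {E : Set ℝ} (hE : MeasurableSet E)
    (hpos : P {ω | (fun j => ξ j ω) ∈ massBounded p q u K ∩ point q ⁻¹' E} ≠ 0) :
    (t : ℝ≥0∞) ≤ dimH E := by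
  obtain ⟨δ, hδ, rfl⟩ : ∃ δ : ℝ, 0 < δ ∧ u = t + δ := ⟨u - t, sub_pos.2 htu, by ring⟩
  have hξ : Measurable fun ω j => ξ j ω := measurable_pi_lambda _ hm
  have hX : Measurable fun ω => point q fun j => ξ j ω := (measurable_point hq hsum).comp hξ
  set G : Set Ω := (fun ω j => ξ j ω) ⁻¹' massBounded p q (t + δ) K with hG
  set C : ℝ≥0∞ := (2 * s : ℕ) * ENNReal.ofReal K * ∑' k, ENNReal.ofReal (maxProd q k ^ δ) with hC
  have hCtop : C ≠ ∞ := by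
    refine ENNReal.mul_ne_top (ENNReal.mul_ne_top (ENNReal.natCast_ne_top _)
      ENNReal.ofReal_ne_top) ?_
    rw [tsum_eq_zero_add' ENNReal.summable]
    exact ENNReal.add_ne_top.2 ⟨ENNReal.ofReal_ne_top, tsum_maxProd_rpow_ne_top (hS δ hδ)⟩
  -- Only the part of the distribution carried by mass-bounded sequences obeys a uniform power bound
  -- on small sets.
  let μ : Measure ℝ := (P.restrict G).map fun ω => point q fun j => ξ j ω
  have hμ : ∀ T, MeasurableSet T →
      μ T = P {ω | (fun j => ξ j ω) ∈ massBounded p q (t + δ) K ∩ point q ⁻¹' T} := by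
    intro T hT
    rw [Measure.map_apply hX hT, Measure.restrict_apply (hX hT), Set.inter_comm]
    rfl
  have hbound : ∀ T : Set ℝ, Metric.ediam T ≤ ENNReal.ofReal (1 / 2) →
      μ T ≤ C * Metric.ediam T ^ (t : ℝ) := by
    intro T hT
    set x := (Metric.ediam T).toReal with hx
    have hfin : Metric.ediam T ≠ ∞ := ne_top_of_le_ne_top ENNReal.ofReal_ne_top hT
    have hx0 : 0 ≤ x := ENNReal.toReal_nonneg
    have hx1 : x ≤ 1 / 2 := ENNReal.toReal_le_of_le_ofReal (by norm_num) hT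
    -- The diameter may be 0, so the estimate is used with r = x + e for small e > 0, and then e
    -- tends to 0.
    have hlim : Tendsto (fun e : ℝ => C * ENNReal.ofReal (x + e) ^ (t : ℝ)) (𝓝[>] 0)
        (𝓝 (C * Metric.ediam T ^ (t : ℝ))) := by
      refine ENNReal.Tendsto.const_mul ?_ (Or.inr hCtop)
      have h1 : Tendsto (fun e : ℝ => ENNReal.ofReal (x + e)) (𝓝[>] 0) (𝓝 (Metric.ediam T)) := by
        rw [← ENNReal.ofReal_toReal hfin, ← hx]
        refine ENNReal.tendsto_ofReal (tendsto_nhdsWithin_of_tendsto_nhds ?_)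
        simpa using (tendsto_const_nhds (x := x)).add (tendsto_id (α := ℝ) (x := 𝓝 0))
      exact (ENNReal.continuous_rpow_const.tendsto _).comp h1
    refine ge_of_tendsto hlim ?_
    filter_upwards [Ioo_mem_nhdsGT (show (0 : ℝ) < 1 / 2 by norm_num)] with e he
    -- Passing to the closure makes the set measurable without changing its diameter.
    refine (measure_mono subset_closure).trans ?_
    rw [hμ _ isClosed_closure.measurableSet]
    refine measure_massBounded_inter_le hi hlaw hq hsum hS t.coe_nonneg hδ hK
      (by linarith [he.1]) (by linarith [he.2]) fun y hy z hz => ?_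
    have h1 : edist y z ≤ Metric.ediam T := by
      rw [← Metric.ediam_closure]; exact Metric.edist_le_ediam_of_mem hy hz
    rw [edist_dist] at h1
    have h2 : dist y z ≤ x := (ENNReal.ofReal_le_iff_le_toReal hfin).1 h1
    rw [Real.dist_eq] at h2
    linarith [he.1]
  -- The factor (C + 1)⁻¹ is finite and nonzero even when C = 0.
  have hle : (C + 1)⁻¹ • μ ≤ μH[(t : ℝ)] := by
    refine Measure.le_hausdorffMeasure _ _ (ENNReal.ofReal (1 / 2)) (by norm_num) fun T hT => ?_
    rw [Measure.smul_apply, smul_eq_mul, mul_comm, ← div_eq_mul_inv]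
    refine ENNReal.div_le_of_le_mul' ((hbound T hT).trans ?_)
    gcongr
    exact le_self_add
  refine le_dimH_of_hausdorffMeasure_ne_zero fun h0 => ?_
  have h1 := hle E
  rw [h0, Measure.smul_apply, smul_eq_mul, nonpos_iff_eq_zero, mul_eq_zero] at h1
  rcases h1 with h1 | h1
  · exact ENNReal.inv_ne_zero.2 (ENNReal.add_ne_top.2 ⟨hCtop, ENNReal.one_ne_top⟩) h1
  · rw [hμ E hE] at h1
    exact hpos h1

/-- From some rank on, mass ≤ length^u; the finitely many earlier ranks are absorbed into the
constant. Natural constants allow a countable union over N later. -/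
theorem exists_mem_massBounded (hq : ∀ i k, 0 < q i k) (hsum : ∀ k, ∑ i, q i k = 1)
    (hS : ∀ δ : ℝ, 0 < δ → supTailSum q δ < ∞) {u : ℝ}
    (hlt : ((u : ℝ) : EReal) <
      liminf (fun n : ℕ => ((cumEntropy p n / cumCrossEntropy p q n : ℝ) : EReal)) atTop)
    {α : ℕ → Fin s} (hα : α ∈ minimalDigits p q) : ∃ N : ℕ, α ∈ massBounded p q u N := by
  obtain ⟨c, hc1, hc2⟩ := EReal.lt_iff_exists_real_btwn.1 hlt
  have hc1 : u < c := EReal.coe_lt_coe_iff.1 hc1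
  have hev : ∀ᶠ n in atTop, cylProd p α n / cylProd q α n ^ u ≤ 1 := by
    filter_upwards [eventually_lt_of_lt_liminf hc2, hα.2.eventually_const_lt (sub_neg.2 hc1),
      eventually_sum_log_neg hq hsum hS α] with n hn1 hn2 hn3
    have hn1 : c < cumEntropy p n / cumCrossEntropy p q n := by exact_mod_cast hn1
    have hr : u < (∑ j ∈ Finset.range n, Real.log (p (α j) j)) /
        (∑ j ∈ Finset.range n, Real.log (q (α j) j)) := by linarith
    rw [lt_div_iff_of_neg hn3, ← log_cylProd hα.1, ← log_cylProd fun j => hq _ _] at hr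
    have hpos : 0 < cylProd p α n := Finset.prod_pos fun j _ => hα.1 j
    rw [div_le_one (Real.rpow_pos_of_pos (cylProd_pos hq α n) u),
      Real.rpow_def_of_pos (cylProd_pos hq α n), ← Real.log_le_iff_le_exp hpos]
    linarith
  obtain ⟨M, hM⟩ := (isBoundedUnder_of_eventually_le hev).bddAbove_range
  obtain ⟨N, hN⟩ := exists_nat_ge M
  refine ⟨N, fun n => ?_⟩
  rw [← div_le_iff₀ (Real.rpow_pos_of_pos (cylProd_pos hq α n) u)]
  exact (hM ⟨n, rfl⟩).trans hN

/-- Almost every sequence is mass-bounded for some natural constant and codes a point of `E`. By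
countable additivity one constant has positive probability, and the mass distribution bound applies
to it. -/
theorem le_dimH_of_measure_eq_one (hm : ∀ k, Measurable (ξ k)) (hi : iIndepFun ξ P)
    (hlaw : ∀ i k, P.real {ω | ξ k ω = i} = p i k) (hq : ∀ i k, 0 < q i k)
    (hsum : ∀ k, ∑ i, q i k = 1) (hS : ∀ δ : ℝ, 0 < δ → supTailSum q δ < ∞)
    (hmin : ∀ᵐ ω ∂P, (fun k => ξ k ω) ∈ minimalDigits p q) {t : ℝ≥0}
    (hlt : ((t : ℝ) : EReal) <
      liminf (fun n : ℕ => ((cumEntropy p n / cumCrossEntropy p q n : ℝ) : EReal)) atTop)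
    {E : Set ℝ} (hE : MeasurableSet E) (hE1 : P.map (fun ω => point q fun k => ξ k ω) E = 1) :
    (t : ℝ≥0∞) ≤ dimH E := by
  obtain ⟨u, htu, hu⟩ := EReal.lt_iff_exists_real_btwn.1 hlt
  have hX : Measurable fun ω => point q fun j => ξ j ω :=
    (measurable_point hq hsum).comp (measurable_pi_lambda _ hm)
  rw [Measure.map_apply hX hE] at hE1
  have hEae : ∀ᵐ ω ∂P, (point q fun k => ξ k ω) ∈ E :=
    (mem_ae_iff_prob_eq_one (hX hE)).2 hE1
  by_contra hcon
  have hnull : ∀ N : ℕ,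
      P {ω | (fun j => ξ j ω) ∈ massBounded p q u N ∩ point q ⁻¹' E} = 0 := fun N => by
    by_contra h
    exact hcon (le_dimH_of_massBounded hm hi hlaw hq hsum hS (EReal.coe_lt_coe_iff.1 htu)
      N.cast_nonneg hE h)
  have hfalse : ∀ᵐ _ω ∂P, False := by
    filter_upwards [hmin, hEae, ae_all_iff.2 fun N => measure_eq_zero_iff_ae_notMem.1 (hnull N)]
      with ω h1 h2 h3
    obtain ⟨N, hN⟩ := exists_mem_massBounded hq hsum hS hu h1
    exact h3 N ⟨hN, h2⟩
  obtain ⟨_, h⟩ := hfalse.exists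
  exact h

end MassDistribution

end QStar

/-! ### Conclusion -/

theorem EReal.coe_ennreal_le_of_forall_nnreal {x : ℝ≥0∞} {d : EReal} (hd : 0 ≤ d)
    (h : ∀ t : ℝ≥0, 0 < t → d < ((t : ℝ) : EReal) → x ≤ t) : (x : EReal) ≤ d := by
  by_contra! hlt
  obtain ⟨c, hc1, hc2⟩ := EReal.lt_iff_exists_real_btwn.1 hlt
  have hc0 : 0 < c := by exact_mod_cast hd.trans_lt hc1
  lift c to ℝ≥0 using hc0.le
  have := EReal.coe_ennreal_le_coe_ennreal_iff.2 (h c (by exact_mod_cast hc0) hc1)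
  exact absurd hc2 (not_lt.2 (by rwa [EReal.coe_nnreal_eq_coe_real] at this))

theorem EReal.le_coe_ennreal_of_forall_nnreal {x : ℝ≥0∞} {d : EReal}
    (h : ∀ t : ℝ≥0, ((t : ℝ) : EReal) < d → (t : ℝ≥0∞) ≤ x) : d ≤ (x : EReal) := by
  by_contra! hlt
  obtain ⟨c, hc1, hc2⟩ := EReal.lt_iff_exists_real_btwn.1 hlt
  have hc0 : 0 < c := by exact_mod_cast (EReal.coe_ennreal_nonneg x).trans_lt hc1
  lift c to ℝ≥0 using hc0.le
  have := EReal.coe_ennreal_le_coe_ennreal_iff.2 (h c hc2)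
  exact absurd hc1 (not_lt.2 (by rwa [EReal.coe_nnreal_eq_coe_real] at this))

theorem theorem3p1 {Ω : Type*} [MeasurableSpace Ω] (P : Measure Ω) [IsProbabilityMeasure P]
    (s : ℕ) (p q : Fin s → ℕ → ℝ)
    (hq_pos : ∀ i k, 0 < q i k) (hq_sum : ∀ k, ∑ i : Fin s, q i k = 1)
    (ξ : ℕ → Ω → Fin s) (hξ_meas : ∀ k, Measurable (ξ k)) (hξ_indep : iIndepFun ξ P)
    (hξ_law : ∀ i k, P.real {ω | ξ k ω = i} = p i k)
    (hS : ∀ δ : ℝ, 0 < δ → QStar.supTailSum q δ < ∞)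
    (hd : Summable fun j : ℕ => QStar.digitVariance p q j / ((j : ℝ) + 1) ^ 2)
    (hB : 0 < liminf (fun n : ℕ => ((QStar.cumCrossEntropy p q n / (n : ℝ) : ℝ) : EReal)) atTop) :
    ((QStar.dimDistribution (P.map fun ω => QStar.point q fun k => ξ k ω) : ℝ≥0∞) : EReal) =
        liminf (fun n : ℕ =>
          ((QStar.cumEntropy p n / QStar.cumCrossEntropy p q n : ℝ) : EReal)) atTop ∧
      MeasurableSet (QStar.minimalSupport p q) ∧
      (P.map fun ω => QStar.point q fun k => ξ k ω) (QStar.minimalSupport p q) = 1 ∧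
      dimH (QStar.minimalSupport p q) =
        QStar.dimDistribution (P.map fun ω => QStar.point q fun k => ξ k ω) := by
  have hp0 : ∀ i k, 0 ≤ p i k := QStar.prob_nonneg hξ_law
  have hp : ∀ k, ∑ i, p i k = 1 := QStar.sum_prob hξ_meas hξ_law
  have hmin := QStar.ae_mem_minimalDigits hξ_meas hξ_indep hξ_law hd hB
  have hX : Measurable fun ω => QStar.point q fun k => ξ k ω :=
    (QStar.measurable_point hq_pos hq_sum).comp (measurable_pi_lambda _ hξ_meas)
  have hA : MeasurableSet (QStar.minimalSupport p q) := by
    rw [QStar.minimalSupport_eq_image]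
    exact QStar.measurableSet_image_point hq_pos hq_sum (QStar.measurableSet_minimalDigits p q)
  have hν : (P.map fun ω => QStar.point q fun k => ξ k ω) (QStar.minimalSupport p q) = 1 := by
    rw [Measure.map_apply hX hA, ← mem_ae_iff_prob_eq_one (hX hA)]
    filter_upwards [hmin] with ω hω
    exact ⟨_, rfl, hω⟩
  obtain ⟨c, hc, hcB⟩ := QStar.exists_cumCrossEntropy_gt hB
  have hnonneg : 0 ≤ liminf (fun n : ℕ =>
      ((QStar.cumEntropy p n / QStar.cumCrossEntropy p q n : ℝ) : EReal)) atTop := by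
    refine le_liminf_of_le (by isBoundedDefault) ?_
    filter_upwards [hcB] with n hn
    exact_mod_cast div_nonneg (QStar.cumEntropy_nonneg hξ_law n)
      ((by positivity : (0 : ℝ) ≤ c * n).trans hn.le)
  have hle : QStar.dimDistribution (P.map fun ω => QStar.point q fun k => ξ k ω) ≤
      dimH (QStar.minimalSupport p q) := iInf₂_le _ ⟨hA, hν⟩
  have hupper := EReal.coe_ennreal_le_of_forall_nnreal hnonneg fun t ht hlt =>
    QStar.dimH_minimalSupport_le hq_pos hq_sum hp0 hp hS ht hlt
  have hlower := EReal.le_coe_ennreal_of_forall_nnreal fun t hlt =>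
    le_iInf₂ fun E (hE : MeasurableSet E ∧
      (P.map fun ω => QStar.point q fun k => ξ k ω) E = 1) =>
      QStar.le_dimH_of_measure_eq_one hξ_meas hξ_indep hξ_law hq_pos hq_sum hS hmin hlt hE.1 hE.2
  -- The cycle dim ν ≤ dim A ≤ liminf ≤ dim ν makes all three equal.
  refine ⟨le_antisymm ((EReal.coe_ennreal_le_coe_ennreal_iff.2 hle).trans hupper) hlower, hA, hν,
    le_antisymm (EReal.coe_ennreal_le_coe_ennreal_iff.1 (hupper.trans hlower)) hle⟩
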